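/- For a Hausdorff space $X$, let $R(X)$ be the Boolean algebra of regular closed subsets of $X$ (sets $A$ with $A=\operatorname{cl}\operatorname{int}A$; the order is inclusion and the meet is $A\wedge B=\operatorname{cl}\operatorname{int}(A\cap B)$), and let $\theta X$ be the set of ultrafilters of $R(X)$ with the topology whose base consists of the sets $\lambda(A)=\{\mathscr U\in\theta X: A\in\mathscr U\}$, $A\in R(X)$. Let $EX=\{\mathscr U\in\theta X:\bigcap\mathscr U\neq\emptyset\}$ be the Iliadis absolute of $X$, a subspace of $\theta X$, and let $k_X:EX\to X$ be the map with $k_X(\mathscr U)\in\bigcap\mathscr U$. Given a choice of a point $\mathscr U_x\in k_X^{-1}\{x\}$ for each $x\in X$, let $sX=\{\mathscr U_x:x\in X\}$, a subspace of $EX$. For a space $Y$, a free open ultrafilter on $Y$ is a maximal proper filter $\mathscr U$ of open subsets of $Y$ such that $\bigcap\{\operatorname{cl}_Y U:U\in\mathscr U\}=\emptyset$. The Katětov extension $\kappa Y$ is the union of $Y$ and the set of all free open ultrafilters on $Y$, with the topology whose base consists of the open subsets of $Y$ and the sets $U\cup\{\mathscr U\}$, where $\mathscr U$ is a free open ultrafilter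 on $Y$ and $U\in\mathscr U$. A space $X$ is selectively highly divergent (SHD) if for every sequence $(U_n)_{n<\omega}$ of nonempty open subsets of $X$ there are points $x_n\in U_n$ such that $(x_n)$ has no convergent subsequence; $X$ is semiregular if its regular open sets form a base; $X$ is extremally disconnected if the closure of every open set is open. **Theorem.** Choices of points $\mathscr U_x\in k_{\mathbb Q}^{-1}\{x\}$ ($x\in\mathbb Q$) exist. For each such choice, with $s\mathbb Q=\{\mathscr U_x:x\in\mathbb Q\}$, there is a sequence $(\mathscr V_n)_{n<\omega}$ of free open ultrafilters on $s\mathbb Q$ such that every nonempty open subset of $s\mathbb Q$ belongs to some $\mathscr V_n$; and for every such sequence the subspace $$\mathbb Q_*=s\mathbb Q\cup\{\mathscr V_n:n<\omega\}$$ of $\kappa(s\mathbb Q)$ is Hausdorff, extremally disconnected, has no isolated points and is not semiregular. In particular, $\mathbb Q_*$ is a countable SHD space that is not semiregular. -/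

import Mathlib

open Set Filter Topology

/-- A space is selectively highly divergent (SHD) if from every sequence of nonempty open sets one
can select points forming a sequence without convergent subsequences. -/
def IsSHD (X : Type*) [TopologicalSpace X] : Prop :=
  ∀ U : ℕ → Set X, (∀ n, IsOpen (U n) ∧ (U n).Nonempty) →
    ∃ x : ℕ → X, (∀ n, x n ∈ U n) ∧
      ∀ φ : ℕ → ℕ, StrictMono φ → ∀ a : X, ¬ Tendsto (x ∘ φ) atTop (𝓝 a)

/-- A space is semiregular if its regular open sets form a base. -/
def IsSemiregular (X : Type*) [TopologicalSpace X] : Prop :=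
  TopologicalSpace.IsTopologicalBasis {U : Set X | interior (closure U) = U}

/-- Regular closed sets, the elements of the Boolean algebra `R(X)`. -/
def IsRegClosed {X : Type*} [TopologicalSpace X] (A : Set X) : Prop :=
  closure (interior A) = A

/-- Proper filters in the Boolean algebra `R(X)`, whose order is inclusion and whose meet is
`A ∧ B = cl (int (A ∩ B))`. -/
structure IsRegClosedFilter {X : Type*} [TopologicalSpace X] (F : Set (Set X)) : Prop where
  regClosed : ∀ A ∈ F, IsRegClosed A
  univ_mem : univ ∈ F
  empty_notMem : ∅ ∉ F
  meet_mem : ∀ A ∈ F, ∀ B ∈ F, closure (interior (A ∩ B)) ∈ F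
  mem_of_subset : ∀ A ∈ F, ∀ B, IsRegClosed B → A ⊆ B → B ∈ F

/-- The set `θX` of all `R(X)`-ultrafilters, i.e. maximal proper filters in `R(X)`. -/
def ThetaSpace (X : Type*) [TopologicalSpace X] : Type _ :=
  {F : Set (Set X) // Maximal IsRegClosedFilter F}

/-- `λ(A)`, the set of all `R(X)`-ultrafilters that contain `A`. -/
def thetaBasic {X : Type*} [TopologicalSpace X] (A : Set X) : Set (ThetaSpace X) :=
  {F | A ∈ F.1}

instance (X : Type*) [TopologicalSpace X] : TopologicalSpace (ThetaSpace X) :=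
  TopologicalSpace.generateFrom {S | ∃ A : Set X, IsRegClosed A ∧ S = thetaBasic A}

/-- The Iliadis absolute `EX`, a subspace of `θX`. -/
abbrev IliadisAbsolute (X : Type*) [TopologicalSpace X] : Type _ :=
  {F : ThetaSpace X // (⋂₀ F.1).Nonempty}

/-- The map `k_X : EX → X` with `k_X(F) ∈ ⋂ F`; for Hausdorff `X` this point is unique. -/
noncomputable def iliadisMap (X : Type*) [TopologicalSpace X] (F : IliadisAbsolute X) : X :=
  F.2.some

/-- A choice of one point `u x` in each fibre of `k_X`. -/
def IsFibreSelection {X : Type*} [TopologicalSpace X] (u : X → IliadisAbsolute X) : Prop :=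
  ∀ x, iliadisMap X (u x) = x

/-- The space `sX = {u x : x ∈ X}`, a subspace of `EX`. -/
abbrev SSpace {X : Type*} [TopologicalSpace X] (u : X → IliadisAbsolute X) : Type _ :=
  ↥(Set.range u)

/-- Proper filters in the lattice of open sets. -/
structure IsOpenFilter {Y : Type*} [TopologicalSpace Y] (F : Set (Set Y)) : Prop where
  isOpen : ∀ U ∈ F, IsOpen U
  univ_mem : univ ∈ F
  empty_notMem : ∅ ∉ F
  inter_mem : ∀ U ∈ F, ∀ V ∈ F, U ∩ V ∈ F
  mem_of_subset : ∀ U ∈ F, ∀ V, IsOpen V → U ⊆ V → V ∈ F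

/-- Free open ultrafilters: maximal proper open filters with empty adherence. -/
structure FreeOpenUltrafilter (Y : Type*) [TopologicalSpace Y] where
  sets : Set (Set Y)
  maximal : Maximal IsOpenFilter sets
  free : (⋂ U ∈ sets, closure U) = ∅

/-- The underlying set of the Katětov extension `κY`: the points of `Y` together with the free open
ultrafilters on `Y`. -/
inductive KatetovExtension (Y : Type*) [TopologicalSpace Y] where
  | pt (y : Y) : KatetovExtension Y
  | ultra (F : FreeOpenUltrafilter Y) : KatetovExtension Y

/-- The topology of `κY`, with base the open sets of `Y` and the sets `U ∪ {F}` with `U ∈ F`. -/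
instance (Y : Type*) [TopologicalSpace Y] : TopologicalSpace (KatetovExtension Y) :=
  TopologicalSpace.generateFrom
    ({S | ∃ U : Set Y, IsOpen U ∧ S = KatetovExtension.pt '' U} ∪
     {S | ∃ (F : FreeOpenUltrafilter Y) (U : Set Y), U ∈ F.sets ∧
        S = KatetovExtension.pt '' U ∪ {KatetovExtension.ultra F}})

/-- Every nonempty open set belongs to some member of the sequence `V` of free open
ultrafilters. -/
def IsOpenCovering {Y : Type*} [TopologicalSpace Y] (V : ℕ → FreeOpenUltrafilter Y) : Prop :=
  ∀ U : Set Y, IsOpen U → U.Nonempty → ∃ n, U ∈ (V n).sets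

/-- The subspace `Y ∪ {V n : n < ω}` of `κY`. -/
abbrev StarSpace {Y : Type*} [TopologicalSpace Y] (V : ℕ → FreeOpenUltrafilter Y) : Type _ :=
  ↥(Set.range (KatetovExtension.pt (Y := Y)) ∪ Set.range fun n => KatetovExtension.ultra (V n))

/-!
A regular closed set `A` contains `k_X(F)` whenever `A ∈ F`, and belongs to `F` whenever `k_X(F)`
lies in its interior. Hence `k_X : sX → X` is a continuous bijection for which the preimages of the
nonempty open sets form a `π`-base, and the preimage of an open set `O` is dense in the clopen trace
of `λ(cl O)`. The latter makes `sX` extremally disconnected.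

If `X` is nowhere locally compact, the closure of a nonempty open `W ⊆ X` belongs to an ultrafilter
without limit, whose open members, cut down to `W` and pulled back to `sX`, generate a free open
filter. Carrying this out along a countable `π`-base yields the sequence `V`.

`Y` is open and dense in `κY`, and `F ∈ κY \ Y` is adherent to an open set precisely when the trace
of that set on `Y` belongs to `F`. So extremal disconnectedness passes from `Y` to `κY`, and then to
dense subspaces. A regular open set that meets `Y` contains some `V n`, hence is not contained in
the open set `Y`: semiregularity fails. Finally, in an extremally disconnected Hausdorff space
convergent sequences are eventually constant, because a nontrivial one would split into two
subsequences with disjoint open neighbourhoods and a common limit. Without isolated points this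
gives SHD.
-/

section ProperFilterIn

variable {α : Type*} {L F : Set (Set α)}

/-- `F` is a proper filter in the family `L` of sets, ordered by inclusion. Directedness replaces
closure under binary meets, so that the definition covers both the open sets, where meets are
intersections, and the regular closed sets, where they are not. -/
structure IsProperFilterIn (L F : Set (Set α)) : Prop where
  subset : F ⊆ L
  nonempty : F.Nonempty
  empty_notMem : ∅ ∉ F
  directedOn : DirectedOn (· ⊇ ·) F
  mem_of_subset : ∀ A ∈ F, ∀ B ∈ L, A ⊆ B → B ∈ F

theorem isProperFilterIn_upward {B : Set (Set α)} (hBL : B ⊆ L) (hne : B.Nonempty)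
    (hempty : ∅ ∉ B) (hdir : DirectedOn (· ⊇ ·) B) :
    IsProperFilterIn L {A ∈ L | ∃ S ∈ B, S ⊆ A} where
  subset := sep_subset _ _
  nonempty := hne.mono fun S hS => ⟨hBL hS, S, hS, subset_rfl⟩
  empty_notMem := by
    rintro ⟨-, S, hS, hSempty⟩
    exact hempty (subset_empty_iff.1 hSempty ▸ hS)
  directedOn := by
    rintro A ⟨-, S, hS, hSA⟩ A' ⟨-, S', hS', hSA'⟩
    obtain ⟨T, hT, hTS, hTS'⟩ := hdir S hS S' hS'
    exact ⟨T, ⟨hBL hT, T, hT, subset_rfl⟩, hTS.trans hSA, hTS'.trans hSA'⟩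
  mem_of_subset := by
    rintro A ⟨-, S, hS, hSA⟩ A' hA' hAA'
    exact ⟨hA', S, hS, hSA.trans hAA'⟩

theorem IsProperFilterIn.exists_maximal (hF : IsProperFilterIn L F) :
    ∃ G, F ⊆ G ∧ Maximal (IsProperFilterIn L) G := by
  refine zorn_subset_nonempty {G | IsProperFilterIn L G} (fun c hc hchain hne => ?_) F hF
  obtain ⟨G, hG⟩ := hne
  refine ⟨⋃₀ c, ⟨sUnion_subset fun H hH => (hc hH).subset,
    (hc hG).nonempty.mono (subset_sUnion_of_mem hG), ?_,
    directedOn_sUnion hchain.directedOn fun H hH => (hc hH).directedOn, ?_⟩,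
    fun H => subset_sUnion_of_mem⟩
  · rintro ⟨H, hH, hempty⟩
    exact (hc hH).empty_notMem hempty
  · rintro A ⟨H, hH, hA⟩ B hB hAB
    exact ⟨H, hH, (hc hH).mem_of_subset A hA B hB hAB⟩

theorem exists_maximal_isProperFilterIn_superset {B : Set (Set α)} (hBL : B ⊆ L)
    (hne : B.Nonempty) (hempty : ∅ ∉ B) (hdir : DirectedOn (· ⊇ ·) B) :
    ∃ G, B ⊆ G ∧ Maximal (IsProperFilterIn L) G := by
  obtain ⟨G, hG, hGmax⟩ := (isProperFilterIn_upward hBL hne hempty hdir).exists_maximal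
  exact ⟨G, fun S hS => hG ⟨hBL hS, S, hS, subset_rfl⟩, hGmax⟩

theorem mem_of_maximal_isProperFilterIn (hF : Maximal (IsProperFilterIn L) F) {A : Set α}
    (hA : A ∈ L) {meet : Set α → Set α} (hmeet : ∀ B ∈ F, IsGreatest {C ∈ L | C ⊆ A ∩ B} (meet B))
    (hne : ∀ B ∈ F, (meet B).Nonempty) : A ∈ F := by
  have hgen : IsProperFilterIn L {C ∈ L | ∃ S ∈ meet '' F, S ⊆ C} := by
    refine isProperFilterIn_upward ?_ (hF.prop.nonempty.image meet) ?_ ?_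
    · exact image_subset_iff.2 fun B hB => (hmeet B hB).1.1
    · rintro ⟨B, hB, hempty⟩
      exact (hne B hB).ne_empty hempty
    · rintro _ ⟨B, hB, rfl⟩ _ ⟨B', hB', rfl⟩
      obtain ⟨D, hD, hDB, hDB'⟩ := hF.prop.directedOn B hB B' hB'
      have hDmeet := (hmeet D hD).1
      exact ⟨meet D, mem_image_of_mem meet hD,
        (hmeet B hB).2 ⟨hDmeet.1, hDmeet.2.trans (inter_subset_inter_right A hDB)⟩,
        (hmeet B' hB').2 ⟨hDmeet.1, hDmeet.2.trans (inter_subset_inter_right A hDB')⟩⟩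
  obtain ⟨B, hB⟩ := hF.prop.nonempty
  refine hF.le_of_ge hgen (fun C hC => ⟨hF.prop.subset hC, meet C, mem_image_of_mem meet hC, ?_⟩)
    ⟨hA, meet B, mem_image_of_mem meet hB, ?_⟩
  · exact (hmeet C hC).1.2.trans inter_subset_right
  · exact (hmeet B hB).1.2.trans inter_subset_left

end ProperFilterIn

section RegClosed

variable {X : Type*} [TopologicalSpace X] {A B : Set X}

theorem isRegClosed_closure {U : Set X} (hU : IsOpen U) : IsRegClosed (closure U) :=
  subset_antisymm (closure_minimal interior_subset isClosed_closure)
    (closure_mono hU.subset_interior_closure)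

theorem isRegClosed_univ : IsRegClosed (univ : Set X) := by
  rw [IsRegClosed, interior_univ, closure_univ]

theorem IsRegClosed.isClosed (hA : IsRegClosed A) : IsClosed A :=
  closure_eq_iff_isClosed.1 ((congrArg closure hA).symm.trans (closure_closure.trans hA))

theorem IsRegClosed.closure_compl (hA : IsRegClosed A) : IsRegClosed (closure Aᶜ) :=
  isRegClosed_closure hA.isClosed.isOpen_compl

theorem isGreatest_closure_interior {S : Set X} (hS : IsClosed S) :
    IsGreatest {C | IsRegClosed C ∧ C ⊆ S} (closure (interior S)) := by
  refine ⟨⟨isRegClosed_closure isOpen_interior, closure_minimal interior_subset hS⟩, ?_⟩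
  rintro C ⟨hC, hCS⟩
  rw [← hC]
  exact closure_mono (interior_mono hCS)

theorem isRegClosedFilter_eq_isProperFilterIn :
    IsRegClosedFilter = IsProperFilterIn {A : Set X | IsRegClosed A} := by
  funext F
  refine propext ⟨fun h => ?_, fun h => ?_⟩
  · refine ⟨h.regClosed, ⟨univ, h.univ_mem⟩, h.empty_notMem, fun A hA B hB => ?_, h.mem_of_subset⟩
    have hmeet := (isGreatest_closure_interior
      ((h.regClosed A hA).isClosed.inter (h.regClosed B hB).isClosed)).1.2
    exact ⟨_, h.meet_mem A hA B hB, hmeet.trans inter_subset_left, hmeet.trans inter_subset_right⟩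
  · obtain ⟨C, hC⟩ := h.nonempty
    refine ⟨h.subset, h.mem_of_subset C hC _ isRegClosed_univ (subset_univ C), h.empty_notMem,
      fun A hA B hB => ?_, h.mem_of_subset⟩
    obtain ⟨D, hD, hDA, hDB⟩ := h.directedOn A hA B hB
    refine h.mem_of_subset D hD _ (isRegClosed_closure isOpen_interior) ?_
    exact (isGreatest_closure_interior ((h.subset hA).isClosed.inter (h.subset hB).isClosed)).2
      ⟨h.subset hD, subset_inter hDA hDB⟩

theorem IsRegClosedFilter.nonempty_interior_inter {F : Set (Set X)} (hF : IsRegClosedFilter F)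
    (hA : A ∈ F) (hB : B ∈ F) : (interior (A ∩ B)).Nonempty := by
  rw [← closure_nonempty_iff, nonempty_iff_ne_empty]
  exact ne_of_mem_of_not_mem (hF.meet_mem A hA B hB) hF.empty_notMem

end RegClosed

namespace ThetaSpace

variable {X : Type*} [TopologicalSpace X] (F : ThetaSpace X) {A : Set X}

theorem mem_of_forall_nonempty_interior_inter (hA : IsRegClosed A)
    (h : ∀ B ∈ F.1, (interior (A ∩ B)).Nonempty) : A ∈ F.1 := by
  have hF : Maximal (IsProperFilterIn {A : Set X | IsRegClosed A}) F.1 :=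
    isRegClosedFilter_eq_isProperFilterIn (X := X) ▸ F.2
  exact mem_of_maximal_isProperFilterIn hF hA
    (fun B hB => isGreatest_closure_interior (hA.isClosed.inter (hF.prop.subset hB).isClosed))
    fun B hB => (h B hB).closure

theorem closure_compl_mem_iff (hA : IsRegClosed A) : closure Aᶜ ∈ F.1 ↔ A ∉ F.1 := by
  refine ⟨fun hAc hAF => ?_, fun hAF => ?_⟩
  · have hmeet := F.2.prop.nonempty_interior_inter hAF hAc
    rw [closure_compl, interior_inter] at hmeet
    exact hmeet.ne_empty (disjoint_compl_right.mono_right interior_subset).inter_eq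
  · obtain ⟨B, hB, hAB⟩ : ∃ B ∈ F.1, interior (A ∩ B) = ∅ := by
      by_contra! hmeet
      exact hAF (F.mem_of_forall_nonempty_interior_inter hA hmeet)
    refine F.2.prop.mem_of_subset B hB _ hA.closure_compl ?_
    rw [interior_inter, ← disjoint_iff_inter_eq_empty] at hAB
    rw [← F.2.prop.regClosed B hB, closure_compl]
    exact closure_minimal hAB.subset_compl_left isOpen_interior.isClosed_compl

theorem mem_of_mem_interior {x : X} (hx : x ∈ ⋂₀ F.1) (hA : IsRegClosed A)
    (hxA : x ∈ interior A) : A ∈ F.1 := by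
  by_contra hAF
  have hxAc := hx _ ((F.closure_compl_mem_iff hA).2 hAF)
  rw [closure_compl] at hxAc
  exact hxAc hxA

theorem exists_mem_sInter (x : X) : ∃ F : ThetaSpace X, x ∈ ⋂₀ F.1 := by
  obtain ⟨G, hnhds, hG⟩ := exists_maximal_isProperFilterIn_superset
    (L := {A : Set X | IsRegClosed A}) (B := {A | IsRegClosed A ∧ x ∈ interior A})
    (fun A hA => hA.1) ⟨univ, isRegClosed_univ, by simp⟩ (fun h => by simp at h) (by
      rintro A ⟨hA, hxA⟩ B ⟨hB, hxB⟩
      obtain ⟨⟨hreg, hsub⟩, -⟩ := isGreatest_closure_interior (hA.isClosed.inter hB.isClosed)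
      refine ⟨_, ⟨hreg, isOpen_interior.subset_interior_closure ?_⟩,
        hsub.trans inter_subset_left, hsub.trans inter_subset_right⟩
      rw [interior_inter]
      exact ⟨hxA, hxB⟩)
  rw [← isRegClosedFilter_eq_isProperFilterIn] at hG
  refine ⟨⟨G, hG⟩, fun A hAG => by_contra fun hxA => ?_⟩
  have hA := hG.prop.regClosed A hAG
  exact (closure_compl_mem_iff ⟨G, hG⟩ hA).1 (hnhds ⟨hA.closure_compl,
    hA.isClosed.isOpen_compl.subset_interior_closure hxA⟩) hAG

theorem isTopologicalBasis_thetaBasic :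
    TopologicalSpace.IsTopologicalBasis
      {S : Set (ThetaSpace X) | ∃ A : Set X, IsRegClosed A ∧ S = thetaBasic A} := by
  refine ⟨?_, ?_, rfl⟩
  · rintro _ ⟨A, hA, rfl⟩ _ ⟨B, hB, rfl⟩ F ⟨hFA, hFB⟩
    obtain ⟨⟨hreg, hsub⟩, -⟩ := isGreatest_closure_interior (hA.isClosed.inter hB.isClosed)
    exact ⟨_, ⟨_, hreg, rfl⟩, F.2.prop.meet_mem A hFA B hFB, fun G hG =>
      ⟨G.2.prop.mem_of_subset _ hG A hA (hsub.trans inter_subset_left),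
        G.2.prop.mem_of_subset _ hG B hB (hsub.trans inter_subset_right)⟩⟩
  · exact sUnion_eq_univ_iff.2 fun F => ⟨_, ⟨univ, isRegClosed_univ, rfl⟩, F.2.prop.univ_mem⟩

end ThetaSpace

section IliadisMap

variable {X : Type*} [TopologicalSpace X]

theorem iliadisMap_mem_sInter (F : IliadisAbsolute X) : iliadisMap X F ∈ ⋂₀ F.1.1 :=
  F.2.some_mem

theorem iliadisMap_eq [T2Space X] (F : IliadisAbsolute X) {x : X} (hx : x ∈ ⋂₀ F.1.1) :
    iliadisMap X F = x := by
  by_contra hne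
  obtain ⟨U, V, hU, hV, hFU, hxV, hUV⟩ := t2_separation hne
  have hVF : closure V ∈ F.1.1 :=
    F.1.mem_of_mem_interior hx (isRegClosed_closure hV) (hV.subset_interior_closure hxV)
  exact (hUV.closure_right hU).le_bot ⟨hFU, iliadisMap_mem_sInter F _ hVF⟩

theorem exists_isFibreSelection (X : Type*) [TopologicalSpace X] [T2Space X] :
    ∃ u : X → IliadisAbsolute X, IsFibreSelection u := by
  choose F hF using ThetaSpace.exists_mem_sInter (X := X)
  exact ⟨fun x => ⟨F x, x, hF x⟩, fun x => iliadisMap_eq _ (hF x)⟩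

end IliadisMap

section PiBase

variable {X : Type*} [TopologicalSpace X]

/-- A `π`-base: a family of nonempty open sets such that every nonempty open set contains one of
them. -/
structure IsPiBase (B : Set (Set X)) : Prop where
  isOpen : ∀ W ∈ B, IsOpen W
  nonempty : ∀ W ∈ B, W.Nonempty
  exists_subset : ∀ U, IsOpen U → U.Nonempty → ∃ W ∈ B, W ⊆ U

theorem isPiBase_countableBasis [SecondCountableTopology X] :
    IsPiBase (TopologicalSpace.countableBasis X) where
  isOpen _ := TopologicalSpace.isOpen_of_mem_countableBasis
  nonempty _ := TopologicalSpace.nonempty_of_mem_countableBasis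
  exists_subset U hU hne := by
    obtain ⟨x, hx⟩ := hne
    obtain ⟨W, hW, -, hWU⟩ :=
      (TopologicalSpace.isBasis_countableBasis X).exists_subset_of_mem_open hx hU
    exact ⟨W, hW, hWU⟩

end PiBase

namespace SSpace

variable {X : Type*} [TopologicalSpace X]

/-- The trace on `sX` of the basic open set `λ(A)` of `θX`. -/
def basicOpen (u : X → IliadisAbsolute X) (A : Set X) : Set (SSpace u) :=
  {p | A ∈ p.1.1.1}

/-- The restriction of `k_X` to `sX`. -/
noncomputable def proj (u : X → IliadisAbsolute X) (p : SSpace u) : X :=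
  iliadisMap X p.1

variable {u : X → IliadisAbsolute X} {A : Set X}

theorem isTopologicalBasis_basicOpen :
    TopologicalSpace.IsTopologicalBasis {S | ∃ A : Set X, IsRegClosed A ∧ S = basicOpen u A} := by
  have hbasis := (ThetaSpace.isTopologicalBasis_thetaBasic (X := X)).isInducing
    (IsInducing.subtypeVal.comp (IsInducing.subtypeVal (t := range u)))
  convert hbasis using 1
  ext S
  constructor
  · rintro ⟨A, hA, rfl⟩
    exact ⟨_, ⟨A, hA, rfl⟩, rfl⟩
  · rintro ⟨_, ⟨A, hA, rfl⟩, rfl⟩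
    exact ⟨A, hA, rfl⟩

theorem isClopen_basicOpen (hA : IsRegClosed A) : IsClopen (basicOpen u A) := by
  have hopen {B : Set X} (hB : IsRegClosed B) : IsOpen (basicOpen u B) :=
    isTopologicalBasis_basicOpen.isOpen ⟨B, hB, rfl⟩
  have hcompl : (basicOpen u A)ᶜ = basicOpen u (closure Aᶜ) :=
    ext fun p => (p.1.1.closure_compl_mem_iff hA).symm
  exact ⟨isOpen_compl_iff.1 (hcompl ▸ hopen hA.closure_compl), hopen hA⟩

theorem basicOpen_subset_preimage_proj (A : Set X) : basicOpen u A ⊆ proj u ⁻¹' A :=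
  fun p hp => iliadisMap_mem_sInter p.1 A hp

theorem preimage_proj_interior_subset_basicOpen (hA : IsRegClosed A) :
    proj u ⁻¹' interior A ⊆ basicOpen u A :=
  fun p hp => p.1.1.mem_of_mem_interior (iliadisMap_mem_sInter p.1) hA hp

theorem continuous_proj [RegularSpace X] : Continuous (proj u) := by
  refine continuous_def.2 fun W hW => isOpen_iff_mem_nhds.2 fun p hp => ?_
  obtain ⟨C, hC, hCclosed, hCW⟩ := exists_mem_nhds_isClosed_subset (hW.mem_nhds hp)
  obtain ⟨⟨hreg, hsub⟩, -⟩ := isGreatest_closure_interior hCclosed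
  have hp' : p ∈ basicOpen u (closure (interior C)) :=
    preimage_proj_interior_subset_basicOpen hreg
      (isOpen_interior.subset_interior_closure (mem_interior_iff_mem_nhds.2 hC))
  filter_upwards [(isClopen_basicOpen hreg).isOpen.mem_nhds hp'] with q hq
  exact hCW (hsub (basicOpen_subset_preimage_proj _ hq))

theorem proj_bijective (hu : IsFibreSelection u) : Function.Bijective (proj u) := by
  refine ⟨?_, fun x => ⟨⟨u x, x, rfl⟩, hu x⟩⟩
  rintro ⟨_, x, rfl⟩ ⟨_, y, rfl⟩ hxy
  exact Subtype.ext (congrArg u ((hu x).symm.trans (hxy.trans (hu y))))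

theorem exists_preimage_proj_subset {U : Set (SSpace u)} (hU : IsOpen U) (hne : U.Nonempty) :
    ∃ W : Set X, IsOpen W ∧ W.Nonempty ∧ proj u ⁻¹' W ⊆ U := by
  obtain ⟨p, hp⟩ := hne
  obtain ⟨_, ⟨A, hA, rfl⟩, hpA, hAU⟩ := isTopologicalBasis_basicOpen.exists_subset_of_mem_open hp hU
  refine ⟨interior A, isOpen_interior, ?_,
    (preimage_proj_interior_subset_basicOpen hA).trans hAU⟩
  simpa only [inter_self] using p.1.1.2.prop.nonempty_interior_inter hpA hpA

theorem isPiBase_preimage_proj [RegularSpace X] (hu : IsFibreSelection u) {B : Set (Set X)}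
    (hB : IsPiBase B) : IsPiBase ((proj u ⁻¹' ·) '' B) where
  isOpen := forall_mem_image.2 fun W hW => (hB.isOpen W hW).preimage continuous_proj
  nonempty := forall_mem_image.2 fun W hW =>
    (hB.nonempty W hW).preimage (proj_bijective hu).surjective
  exists_subset U hU hne := by
    obtain ⟨O, hO, hOne, hOU⟩ := exists_preimage_proj_subset hU hne
    obtain ⟨W, hW, hWO⟩ := hB.exists_subset O hO hOne
    exact ⟨_, mem_image_of_mem _ hW, (preimage_mono hWO).trans hOU⟩

theorem closure_preimage_proj (hu : IsFibreSelection u) {O : Set X} (hO : IsOpen O) :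
    closure (proj u ⁻¹' O) = basicOpen u (closure O) := by
  have hreg := isRegClosed_closure hO
  refine subset_antisymm (closure_minimal ?_ (isClopen_basicOpen hreg).isClosed) fun p hp => ?_
  · exact (preimage_mono hO.subset_interior_closure).trans
      (preimage_proj_interior_subset_basicOpen hreg)
  · rw [isTopologicalBasis_basicOpen.mem_closure_iff]
    rintro _ ⟨C, hC, rfl⟩ hpC
    obtain ⟨x, hx⟩ := p.1.1.2.prop.nonempty_interior_inter hp hpC
    rw [interior_inter] at hx
    obtain ⟨y, hyC, hyO⟩ := mem_closure_iff.1 (interior_subset hx.1) _ isOpen_interior hx.2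
    obtain ⟨q, rfl⟩ := (proj_bijective hu).surjective y
    exact ⟨q, preimage_proj_interior_subset_basicOpen hC hyC, hyO⟩

theorem t2Space [T3Space X] (hu : IsFibreSelection u) : T2Space (SSpace u) :=
  .of_injective_continuous (proj_bijective hu).injective continuous_proj

theorem extremallyDisconnected (hu : IsFibreSelection u) : ExtremallyDisconnected (SSpace u) := by
  refine ⟨fun U hU => ?_⟩
  set O : Set X := ⋃₀ {W | IsOpen W ∧ proj u ⁻¹' W ⊆ U}
  have hO : IsOpen O := isOpen_sUnion fun W hW => hW.1
  have hOU : proj u ⁻¹' O ⊆ U := by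
    rw [preimage_sUnion]
    exact iUnion₂_subset fun W hW => hW.2
  have hreg := isRegClosed_closure hO
  have hUO : U ⊆ basicOpen u (closure O) := fun p hp => by
    obtain ⟨_, ⟨A, hA, rfl⟩, hpA, hAU⟩ :=
      isTopologicalBasis_basicOpen.exists_subset_of_mem_open hp hU
    have hAO : interior A ⊆ O := subset_sUnion_of_mem
      ⟨isOpen_interior, (preimage_proj_interior_subset_basicOpen hA).trans hAU⟩
    exact p.1.1.2.prop.mem_of_subset A hpA _ hreg (hA.ge.trans (closure_mono hAO))
  have hclosure : closure U = basicOpen u (closure O) :=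
    subset_antisymm (closure_minimal hUO (isClopen_basicOpen hreg).isClosed)
      (closure_preimage_proj hu hO ▸ closure_mono hOU)
  exact hclosure ▸ (isClopen_basicOpen hreg).isOpen

theorem not_isOpen_singleton (hu : IsFibreSelection u) (hX : ∀ x : X, ¬ IsOpen ({x} : Set X))
    (p : SSpace u) : ¬ IsOpen ({p} : Set (SSpace u)) := by
  intro hp
  obtain ⟨W, hW, hne, hWp⟩ := exists_preimage_proj_subset hp (singleton_nonempty p)
  have hsub : W ⊆ {proj u p} := by
    rw [← image_preimage_eq W (proj_bijective hu).surjective, ← image_singleton]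
    exact image_mono hWp
  exact hX (proj u p) (hne.subset_singleton_iff.1 hsub ▸ hW)

end SSpace

section OpenFilter

variable {Y : Type*} [TopologicalSpace Y]

theorem isOpenFilter_eq_isProperFilterIn :
    IsOpenFilter = IsProperFilterIn {U : Set Y | IsOpen U} := by
  funext F
  refine propext ⟨fun h => ?_, fun h => ?_⟩
  · exact ⟨h.isOpen, ⟨univ, h.univ_mem⟩, h.empty_notMem, fun U hU V hV =>
      ⟨_, h.inter_mem U hU V hV, inter_subset_left, inter_subset_right⟩, h.mem_of_subset⟩
  · obtain ⟨W, hW⟩ := h.nonempty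
    refine ⟨h.subset, h.mem_of_subset W hW _ isOpen_univ (subset_univ W), h.empty_notMem,
      fun U hU V hV => ?_, h.mem_of_subset⟩
    obtain ⟨D, hD, hDU, hDV⟩ := h.directedOn U hU V hV
    exact h.mem_of_subset D hD _ ((h.subset hU).inter (h.subset hV)) (subset_inter hDU hDV)

end OpenFilter

namespace FreeOpenUltrafilter

variable {Y : Type*} [TopologicalSpace Y] (F : FreeOpenUltrafilter Y)

theorem nonempty_of_mem {U : Set Y} (hU : U ∈ F.sets) : U.Nonempty :=
  nonempty_iff_ne_empty.2 (ne_of_mem_of_not_mem hU F.maximal.prop.empty_notMem)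

theorem mem_of_forall_inter_nonempty {U : Set Y} (hU : IsOpen U)
    (h : ∀ W ∈ F.sets, (U ∩ W).Nonempty) : U ∈ F.sets := by
  have hF : Maximal (IsProperFilterIn {U : Set Y | IsOpen U}) F.sets :=
    isOpenFilter_eq_isProperFilterIn (Y := Y) ▸ F.maximal
  exact mem_of_maximal_isProperFilterIn hF hU
    (fun W hW => ⟨⟨hU.inter (hF.prop.subset hW), subset_rfl⟩, fun C hC => hC.2⟩) h

theorem exists_disjoint_of_ne {F G : FreeOpenUltrafilter Y} (hFG : F ≠ G) :
    ∃ U ∈ F.sets, ∃ W ∈ G.sets, Disjoint U W := by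
  by_contra! hmeet
  have hsub : F.sets ⊆ G.sets := fun U hU =>
    G.mem_of_forall_inter_nonempty (F.maximal.prop.isOpen U hU) fun W hW =>
      not_disjoint_iff_nonempty_inter.1 (hmeet U hU W hW)
  have hsets := F.maximal.eq_of_subset G.maximal.prop hsub
  cases F
  cases G
  cases hsets
  exact hFG rfl

theorem exists_notMem_closure (y : Y) : ∃ U ∈ F.sets, y ∉ closure U := by
  have hy : y ∉ ⋂ U ∈ F.sets, closure U := F.free ▸ notMem_empty y
  simpa only [mem_iInter, not_forall, exists_prop] using hy

end FreeOpenUltrafilter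

section ExistsFree

variable {X Y : Type*} [TopologicalSpace X] [TopologicalSpace Y]

theorem exists_isOpen_notMem_closure_of_not_le_nhds [RegularSpace X] {G : Ultrafilter X} {x : X}
    (hG : ¬ (G : Filter X) ≤ 𝓝 x) : ∃ O ∈ G, IsOpen O ∧ x ∉ closure O := by
  obtain ⟨N, hN, hNG⟩ := Filter.not_le.1 hG
  obtain ⟨C, hC, hCclosed, hCN⟩ := exists_mem_nhds_isClosed_subset hN
  refine ⟨Cᶜ, Ultrafilter.compl_mem_iff_notMem.2 fun hCG => hNG (mem_of_superset hCG hCN),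
    hCclosed.isOpen_compl, ?_⟩
  rw [closure_compl, notMem_compl_iff]
  exact mem_interior_iff_mem_nhds.2 hC

theorem exists_ultrafilter_mem_forall_not_le_nhds {S : Set X} (hS : IsClosed S)
    (hSc : ¬ IsCompact S) : ∃ G : Ultrafilter X, S ∈ G ∧ ∀ x, ¬ (G : Filter X) ≤ 𝓝 x := by
  rw [isCompact_iff_ultrafilter_le_nhds'] at hSc
  push Not at hSc
  obtain ⟨G, hSG, hlim⟩ := hSc
  exact ⟨G, hSG, fun x hx => hlim x (isClosed_iff_ultrafilter.1 hS x G hx hSG) hx⟩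

theorem exists_freeOpenUltrafilter_preimage_mem [RegularSpace X] {f : Y → X} (hf : Continuous f)
    (hdense : DenseRange f) {W : Set X} (hW : IsOpen W) (hWc : ¬ IsCompact (closure W)) :
    ∃ F : FreeOpenUltrafilter Y, f ⁻¹' W ∈ F.sets := by
  obtain ⟨G, hWG, hlim⟩ := exists_ultrafilter_mem_forall_not_le_nhds isClosed_closure hWc
  obtain ⟨H, hH, hHmax⟩ := exists_maximal_isProperFilterIn_superset (L := {U : Set Y | IsOpen U})
    (B := (fun O => f ⁻¹' (O ∩ W)) '' {O | IsOpen O ∧ O ∈ G})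
    (by
      rintro _ ⟨O, ⟨hO, -⟩, rfl⟩
      exact (hO.inter hW).preimage hf)
    ⟨_, mem_image_of_mem _ ⟨isOpen_univ, univ_mem⟩⟩
    (by
      rintro ⟨O, ⟨hO, hOG⟩, hempty⟩
      obtain ⟨x, hxO, hxW⟩ := G.nonempty_of_mem (inter_mem hOG hWG)
      obtain ⟨y, hy⟩ := hdense.exists_mem_open (hO.inter hW) (mem_closure_iff.1 hxW O hO hxO)
      exact hempty.le hy)
    (by
      rintro _ ⟨O, ⟨hO, hOG⟩, rfl⟩ _ ⟨O', ⟨hO', hOG'⟩, rfl⟩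
      exact ⟨_, mem_image_of_mem _ ⟨hO.inter hO', inter_mem hOG hOG'⟩,
        preimage_mono (inter_subset_inter_left W inter_subset_left),
        preimage_mono (inter_subset_inter_left W inter_subset_right)⟩)
  have hmem {O : Set X} (hO : IsOpen O) (hOG : O ∈ G) : f ⁻¹' (O ∩ W) ∈ H :=
    hH (mem_image_of_mem _ ⟨hO, hOG⟩)
  rw [← isOpenFilter_eq_isProperFilterIn] at hHmax
  refine ⟨⟨H, hHmax, eq_empty_of_forall_notMem fun y hy => ?_⟩, ?_⟩
  · obtain ⟨O, hOG, hO, hyO⟩ := exists_isOpen_notMem_closure_of_not_le_nhds (hlim (f y))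
    have hyOW : f y ∈ closure (O ∩ W) :=
      hf.closure_preimage_subset _ (mem_iInter₂.1 hy _ (hmem hO hOG))
    exact hyO (closure_mono inter_subset_left hyOW)
  · simpa only [univ_inter] using hmem isOpen_univ univ_mem

theorem exists_isOpenCovering_of_isPiBase [Nonempty Y] {B : Set (Set Y)} (hBc : B.Countable)
    (hB : IsPiBase B) (hfree : ∀ W ∈ B, ∃ F : FreeOpenUltrafilter Y, W ∈ F.sets) :
    ∃ V : ℕ → FreeOpenUltrafilter Y, IsOpenCovering V := by
  obtain ⟨W₀, hW₀, -⟩ := hB.exists_subset univ isOpen_univ univ_nonempty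
  obtain ⟨e, rfl⟩ := hBc.exists_eq_range ⟨W₀, hW₀⟩
  choose V hV using fun n => hfree (e n) (mem_range_self n)
  refine ⟨V, fun U hU hne => ?_⟩
  obtain ⟨_, ⟨n, rfl⟩, hnU⟩ := hB.exists_subset U hU hne
  exact ⟨n, (V n).maximal.prop.mem_of_subset _ (hV n) U hU hnU⟩

end ExistsFree

namespace KatetovExtension

variable {Y : Type*} [TopologicalSpace Y]

theorem pt_injective : Function.Injective (pt (Y := Y)) := fun _ _ => pt.inj

theorem isOpen_iff {O : Set (KatetovExtension Y)} :
    IsOpen O ↔ IsOpen (pt ⁻¹' O) ∧ ∀ F, ultra F ∈ O → pt ⁻¹' O ∈ F.sets := by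
  refine ⟨fun h => ?_, fun ⟨hO, hF⟩ => isOpen_iff_forall_mem_open.2 fun x hx => ?_⟩
  · induction h with
    | basic S hS =>
      rcases hS with ⟨U, hU, rfl⟩ | ⟨F, U, hU, rfl⟩
      · simpa [preimage_image_eq _ pt_injective] using hU
      · have hpre : pt ⁻¹' (pt '' U ∪ {ultra F}) = U := by
          ext y
          simp
        rw [hpre]
        refine ⟨F.maximal.prop.isOpen U hU, fun G hG => ?_⟩
        obtain rfl : G = F := by simpa using hG
        exact hU
    | univ => exact ⟨isOpen_univ, fun F _ => F.maximal.prop.univ_mem⟩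
    | inter S T _ _ hS hT =>
      exact ⟨hS.1.inter hT.1,
        fun F hF => F.maximal.prop.inter_mem _ (hS.2 F hF.1) _ (hT.2 F hF.2)⟩
    | sUnion c _ hc =>
      have hopen : IsOpen (pt ⁻¹' ⋃₀ c) := by
        rw [preimage_sUnion]
        exact isOpen_biUnion fun S hS => (hc S hS).1
      refine ⟨hopen, ?_⟩
      rintro F ⟨S, hS, hFS⟩
      exact F.maximal.prop.mem_of_subset _ ((hc S hS).2 F hFS) _ hopen
        (preimage_mono (subset_sUnion_of_mem hS))
  · cases x with
    | pt y =>
      exact ⟨pt '' (pt ⁻¹' O), image_preimage_subset _ _, .basic _ (Or.inl ⟨_, hO, rfl⟩),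
        mem_image_of_mem _ hx⟩
    | ultra F =>
      exact ⟨pt '' (pt ⁻¹' O) ∪ {ultra F},
        union_subset (image_preimage_subset _ _) (singleton_subset_iff.2 hx),
        .basic _ (Or.inr ⟨F, _, hF F hx, rfl⟩), Or.inr rfl⟩

theorem isOpenEmbedding_pt : IsOpenEmbedding (pt (Y := Y)) := by
  refine .of_continuous_injective_isOpenMap ?_ pt_injective ?_
  · exact continuous_def.2 fun O hO => (isOpen_iff.1 hO).1
  · exact fun U hU => .basic _ (Or.inl ⟨U, hU, rfl⟩)

theorem isOpen_insert_ultra {O : Set (KatetovExtension Y)} (hO : IsOpen O)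
    {F : FreeOpenUltrafilter Y} (hF : pt ⁻¹' O ∈ F.sets) : IsOpen (insert (ultra F) O) := by
  have hpre : pt ⁻¹' insert (ultra F) O = pt ⁻¹' O := by
    ext y
    simp
  rw [isOpen_iff] at hO ⊢
  rw [hpre]
  refine ⟨hO.1, ?_⟩
  rintro G (hGF | hGO)
  · exact ultra.inj hGF ▸ hF
  · exact hO.2 G hGO

theorem insert_ultra_image_pt_mem_nhds {F : FreeOpenUltrafilter Y} {U : Set Y} (hU : U ∈ F.sets) :
    insert (ultra F) (pt '' U) ∈ 𝓝 (ultra F) := by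
  refine (isOpen_insert_ultra ?_ ?_).mem_nhds (mem_insert _ _)
  · exact isOpenEmbedding_pt.isOpenMap U (F.maximal.prop.isOpen U hU)
  · rwa [preimage_image_eq U pt_injective]

theorem denseRange_pt : DenseRange (pt (Y := Y)) := by
  refine dense_iff_inter_open.2 ?_
  rintro O hO ⟨y | F, hx⟩
  · exact ⟨pt y, hx, mem_range_self y⟩
  · obtain ⟨y, hy⟩ := F.nonempty_of_mem ((isOpen_iff.1 hO).2 F hx)
    exact ⟨pt y, hy, mem_range_self y⟩

theorem ultra_mem_closure_iff {O : Set (KatetovExtension Y)} (hO : IsOpen O)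
    {F : FreeOpenUltrafilter Y} : ultra F ∈ closure O ↔ pt ⁻¹' O ∈ F.sets := by
  have hpre : IsOpen (pt ⁻¹' O) := (isOpen_iff.1 hO).1
  refine ⟨fun h => F.mem_of_forall_inter_nonempty hpre fun W hW => ?_, fun h => ?_⟩
  · obtain ⟨N, hN, hNopen, hFN⟩ := mem_nhds_iff.1 (insert_ultra_image_pt_mem_nhds hW)
    obtain ⟨y, hyN, hyO⟩ := denseRange_pt.exists_mem_open (hNopen.inter hO)
      (mem_closure_iff.1 h N hNopen hFN)
    have hyW : y ∈ W := by simpa using hN hyN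
    exact ⟨y, hyO, hyW⟩
  · refine mem_closure_iff.2 fun N hN hFN => ?_
    obtain ⟨y, hyN, hyO⟩ := F.nonempty_of_mem
      (F.maximal.prop.inter_mem _ ((isOpen_iff.1 hN).2 F hFN) _ h)
    exact ⟨pt y, hyN, hyO⟩

theorem disjoint_nhds_pt_ultra (y : Y) (F : FreeOpenUltrafilter Y) :
    Disjoint (𝓝 (pt y)) (𝓝 (ultra F)) := by
  obtain ⟨U, hU, hy⟩ := F.exists_notMem_closure y
  refine disjoint_of_disjoint_of_mem ?_
    (isOpenEmbedding_pt.image_mem_nhds.2 (isClosed_closure.isOpen_compl.mem_nhds hy))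
    (insert_ultra_image_pt_mem_nhds hU)
  rw [disjoint_insert_right, disjoint_image_iff pt_injective]
  exact ⟨by simp, disjoint_compl_left.mono_right subset_closure⟩

theorem disjoint_nhds_ultra_ultra {F G : FreeOpenUltrafilter Y} (hFG : F ≠ G) :
    Disjoint (𝓝 (ultra F)) (𝓝 (ultra G)) := by
  obtain ⟨U, hU, W, hW, hUW⟩ := FreeOpenUltrafilter.exists_disjoint_of_ne hFG
  refine disjoint_of_disjoint_of_mem ?_ (insert_ultra_image_pt_mem_nhds hU)
    (insert_ultra_image_pt_mem_nhds hW)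
  rw [disjoint_insert_left, disjoint_insert_right, disjoint_image_iff pt_injective]
  exact ⟨by simpa using hFG, by simp, hUW⟩

instance [T2Space Y] : T2Space (KatetovExtension Y) := by
  refine t2Space_iff_disjoint_nhds.2 ?_
  rintro (y | F) (z | G) hne
  · rw [← isOpenEmbedding_pt.map_nhds_eq, ← isOpenEmbedding_pt.map_nhds_eq,
      disjoint_map pt_injective]
    exact disjoint_nhds_nhds.2 (ne_of_apply_ne pt hne)
  · exact disjoint_nhds_pt_ultra y G
  · exact (disjoint_nhds_pt_ultra z F).symm
  · exact disjoint_nhds_ultra_ultra (ne_of_apply_ne ultra hne)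

instance [ExtremallyDisconnected Y] : ExtremallyDisconnected (KatetovExtension Y) := by
  refine ⟨fun O hO => isOpen_iff.2 ?_⟩
  have hpre : IsOpen (pt ⁻¹' O) := (isOpen_iff.1 hO).1
  rw [isOpenEmbedding_pt.isOpenMap.preimage_closure_eq_closure_preimage
    isOpenEmbedding_pt.continuous]
  have hopen := ExtremallyDisconnected.open_closure _ hpre
  exact ⟨hopen, fun F hF => F.maximal.prop.mem_of_subset _ ((ultra_mem_closure_iff hO).1 hF) _
    hopen subset_closure⟩

end KatetovExtension

section Dense

variable {X Y : Type*} [TopologicalSpace X] [TopologicalSpace Y] {f : X → Y}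

theorem closure_preimage_eq_of_isDenseInducing (hf : IsDenseInducing f) {O : Set Y}
    (hO : IsOpen O) : closure (f ⁻¹' O) = f ⁻¹' closure O := by
  rw [hf.isInducing.closure_eq_preimage_closure_image, image_preimage_eq_inter_range]
  exact congrArg (f ⁻¹' ·) (subset_antisymm (closure_mono inter_subset_left)
    (closure_minimal (hf.dense.open_subset_closure_inter hO) isClosed_closure))

theorem extremallyDisconnected_of_isDenseInducing [ExtremallyDisconnected Y]
    (hf : IsDenseInducing f) : ExtremallyDisconnected X := by
  refine ⟨fun U hU => ?_⟩
  obtain ⟨O, hO, rfl⟩ := hf.isInducing.isOpen_iff.1 hU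
  rw [closure_preimage_eq_of_isDenseInducing hf hO]
  exact (ExtremallyDisconnected.open_closure O hO).preimage hf.continuous

theorem not_isOpen_singleton_of_denseRange (hf : Continuous f) (hinj : Function.Injective f)
    (hdense : DenseRange f) (hX : ∀ x : X, ¬ IsOpen ({x} : Set X)) (y : Y) :
    ¬ IsOpen ({y} : Set Y) := by
  intro hy
  obtain ⟨x, rfl⟩ := hdense.exists_mem_open hy (singleton_nonempty y)
  exact hX x (by simpa only [← image_singleton, hinj.preimage_image] using hy.preimage hf)

end Dense

namespace StarSpace

variable {Y : Type*} [TopologicalSpace Y] {V : ℕ → FreeOpenUltrafilter Y}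

theorem isDenseInducing_val : IsDenseInducing (Subtype.val : StarSpace V → KatetovExtension Y) :=
  ⟨.subtypeVal, by
    simpa only [DenseRange, Subtype.range_coe] using
      KatetovExtension.denseRange_pt.mono subset_union_left⟩

theorem extremallyDisconnected [ExtremallyDisconnected Y] :
    ExtremallyDisconnected (StarSpace V) :=
  extremallyDisconnected_of_isDenseInducing isDenseInducing_val

theorem not_isOpen_singleton (hY : ∀ y : Y, ¬ IsOpen ({y} : Set Y)) (x : StarSpace V) :
    ¬ IsOpen ({x} : Set (StarSpace V)) := by
  let ofPt (y : Y) : StarSpace V := ⟨.pt y, Or.inl (mem_range_self y)⟩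
  refine not_isOpen_singleton_of_denseRange (f := ofPt)
    (KatetovExtension.isOpenEmbedding_pt.continuous.subtype_mk _)
    (fun y z hyz => KatetovExtension.pt_injective (congrArg Subtype.val hyz)) ?_ hY x
  refine dense_iff_inter_open.2 fun U hU hne => ?_
  obtain ⟨O, hO, rfl⟩ := isOpen_induced_iff.1 hU
  obtain ⟨y, hy⟩ := KatetovExtension.denseRange_pt.exists_mem_open hO
    (hne.image Subtype.val |>.mono (image_preimage_subset _ _))
  exact ⟨ofPt y, hy, mem_range_self y⟩

theorem countable [Countable Y] : Countable (StarSpace V) :=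
  ((countable_range _).union (countable_range _)).to_subtype

theorem not_isSemiregular [Nonempty Y] (hV : IsOpenCovering V) :
    ¬ IsSemiregular (StarSpace V) := by
  intro hsemi
  obtain ⟨y⟩ := ‹Nonempty Y›
  obtain ⟨W, hW, hyW, hWY⟩ := hsemi.exists_subset_of_mem_open
    (show (⟨.pt y, Or.inl (mem_range_self y)⟩ : StarSpace V) ∈
      Subtype.val ⁻¹' range KatetovExtension.pt from mem_range_self y)
    (KatetovExtension.isOpenEmbedding_pt.isOpen_range.preimage continuous_subtype_val)
  have hreg : interior (closure W) = W := hW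
  obtain ⟨O, hO, rfl⟩ := isOpen_induced_iff.1 (hreg ▸ isOpen_interior)
  obtain ⟨n, hn⟩ := hV (KatetovExtension.pt ⁻¹' O) (KatetovExtension.isOpen_iff.1 hO).1 ⟨y, hyW⟩
  let p : StarSpace V := ⟨.ultra (V n), Or.inr (mem_range_self n)⟩
  have hp : p ∈ closure (Subtype.val ⁻¹' O) := by
    rw [closure_preimage_eq_of_isDenseInducing isDenseInducing_val hO]
    exact (KatetovExtension.ultra_mem_closure_iff hO).2 hn
  have hinsert : (Subtype.val ⁻¹' insert (.ultra (V n)) O : Set (StarSpace V)) ⊆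
      closure (Subtype.val ⁻¹' O) := by
    rintro q (hq | hq)
    · exact (show q = p from Subtype.ext hq) ▸ hp
    · exact subset_closure hq
  have hpint : p ∈ interior (closure (Subtype.val ⁻¹' O)) :=
    interior_maximal hinsert ((KatetovExtension.isOpen_insert_ultra hO hn).preimage
      continuous_subtype_val) (mem_insert _ _)
  obtain ⟨z, hz⟩ := hWY (hreg ▸ hpint)
  cases hz

end StarSpace

section SHD

variable {X : Type*} [TopologicalSpace X]

theorem exists_strictMono_pairwise_disjoint_of_tendsto [T2Space X] {x : ℕ → X} {a : X}
    (hlim : Tendsto x atTop (𝓝 a)) (hne : ∃ᶠ n in atTop, x n ≠ a) :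
    ∃ φ : ℕ → ℕ, StrictMono φ ∧ ∃ O : ℕ → Set X, (∀ n, IsOpen (O n) ∧ x (φ n) ∈ O n) ∧
      Pairwise (Function.onFun Disjoint O) := by
  choose! A B hA hB hxA haB hAB using fun n (hn : x n ≠ a) => t2_separation hn
  obtain ⟨φ, hφa, hφ⟩ := exists_seq_of_forall_finset_exists (fun n => x n ≠ a)
    (fun m n => m < n ∧ x n ∈ B m) fun s hs => by
      have hev : ∀ᶠ n in atTop, ∀ m ∈ s, m < n ∧ x n ∈ B m :=
        s.eventually_all.2 fun m hm => (eventually_gt_atTop m).and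
          (hlim.eventually ((hB m (hs m hm)).mem_nhds (haB m (hs m hm))))
      exact (hne.and_eventually hev).exists
  refine ⟨φ, fun m n hmn => (hφ m n hmn).1, fun n => A (φ n) ∩ ⋂ m ∈ Iio n, B (φ m),
    fun n => ⟨?_, hxA _ (hφa n), mem_iInter₂.2 fun m hm => (hφ m n hm).2⟩,
    (pairwise_disjoint_on _).2 fun m n hmn => ?_⟩
  · exact (hA _ (hφa n)).inter ((finite_Iio n).isOpen_biInter fun m _ => hB _ (hφa m))
  · exact (hAB _ (hφa m)).mono inter_subset_left
      (inter_subset_right.trans (biInter_subset_of_mem (mem_Iio.2 hmn)))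

theorem eventually_eq_of_tendsto_of_extremallyDisconnected [T2Space X] [ExtremallyDisconnected X]
    {x : ℕ → X} {a : X} (hlim : Tendsto x atTop (𝓝 a)) : ∀ᶠ n in atTop, x n = a := by
  by_contra hne
  obtain ⟨φ, hφ, O, hO, hdisj⟩ :=
    exists_strictMono_pairwise_disjoint_of_tendsto hlim (not_eventually.1 hne)
  have ha {ψ : ℕ → ℕ} (hψ : StrictMono ψ) : a ∈ closure (⋃ n, O (ψ n)) :=
    mem_closure_of_tendsto (hlim.comp (hφ.comp hψ).tendsto_atTop)
      (Eventually.of_forall fun n => mem_iUnion.2 ⟨n, (hO (ψ n)).2⟩)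
  have hparity : Disjoint (⋃ n, O (2 * n)) (⋃ n, O (2 * n + 1)) :=
    disjoint_iUnion_left.2 fun m => disjoint_iUnion_right.2 fun n => hdisj (by lia)
  exact (ExtremallyDisconnected.disjoint_closure_of_disjoint_isOpen hparity
    (isOpen_iUnion fun n => (hO _).1) (isOpen_iUnion fun n => (hO _).1)).le_bot
    ⟨ha fun m n hmn => by lia, ha fun m n hmn => by lia⟩

theorem exists_injective_forall_mem_of_infinite {α : Type*} {U : ℕ → Set α}
    (hU : ∀ n, (U n).Infinite) : ∃ x : ℕ → α, Function.Injective x ∧ ∀ n, x n ∈ U n := by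
  classical
  choose T hTU hTcard using fun n => (hU n).exists_subset_card_eq (n + 1)
  have hall (s : Finset ℕ) : s.card ≤ (s.biUnion T).card := by
    obtain rfl | hs := s.eq_empty_or_nonempty
    · simp
    · calc
        s.card ≤ (Finset.range (s.max' hs + 1)).card :=
          Finset.card_le_card fun m hm => Finset.mem_range_succ_iff.2 (s.le_max' m hm)
        _ = (T (s.max' hs)).card := by rw [Finset.card_range, hTcard]
        _ ≤ (s.biUnion T).card :=
          Finset.card_le_card (Finset.subset_biUnion_of_mem T (s.max'_mem hs))
  obtain ⟨x, hx, hxT⟩ := (Finset.all_card_le_biUnion_card_iff_exists_injective T).1 hall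
  exact ⟨x, hx, fun n => hTU n (hxT n)⟩

theorem isSHD_of_extremallyDisconnected [T2Space X] [ExtremallyDisconnected X]
    (hX : ∀ x : X, ¬ IsOpen ({x} : Set X)) : IsSHD X := by
  intro U hU
  have hinf (n : ℕ) : (U n).Infinite := fun hfin => by
    obtain ⟨hopen, y, hy⟩ := hU n
    exact hX y (isOpen_singleton_of_finite_mem_nhds y (hopen.mem_nhds hy) hfin)
  obtain ⟨x, hx, hxU⟩ := exists_injective_forall_mem_of_infinite hinf
  refine ⟨x, hxU, fun φ hφ a hlim => ?_⟩
  obtain ⟨N, hN⟩ := eventually_atTop.1 (eventually_eq_of_tendsto_of_extremallyDisconnected hlim)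
  have heq : φ N = φ (N + 1) := hx ((hN N le_rfl).trans (hN (N + 1) N.le_succ).symm)
  exact N.succ_ne_self (hφ.injective heq).symm

end SHD

section NowhereLocallyCompact

variable {X : Type*} [TopologicalSpace X]

theorem not_isCompact_closure_of_forall_interior_eq_empty
    (hX : ∀ K : Set X, IsCompact K → interior K = ∅) {W : Set X} (hW : IsOpen W)
    (hne : W.Nonempty) : ¬ IsCompact (closure W) := fun hc =>
  (hne.mono hW.subset_interior_closure).ne_empty (hX _ hc)

theorem not_isOpen_singleton_of_forall_interior_eq_empty
    (hX : ∀ K : Set X, IsCompact K → interior K = ∅) (x : X) : ¬ IsOpen ({x} : Set X) := fun hx =>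
  (singleton_nonempty x).ne_empty (hx.interior_eq ▸ hX {x} isCompact_singleton)

theorem SSpace.exists_isOpenCovering [RegularSpace X] [Nonempty X]
    (hX : ∀ K : Set X, IsCompact K → interior K = ∅) {B : Set (Set X)} (hBc : B.Countable)
    (hB : IsPiBase B) {u : X → IliadisAbsolute X} (hu : IsFibreSelection u) :
    ∃ V : ℕ → FreeOpenUltrafilter (SSpace u), IsOpenCovering V := by
  refine exists_isOpenCovering_of_isPiBase (hBc.image _) (SSpace.isPiBase_preimage_proj hu hB) ?_
  exact forall_mem_image.2 fun W hW => exists_freeOpenUltrafilter_preimage_mem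
    SSpace.continuous_proj (SSpace.proj_bijective hu).surjective.denseRange (hB.isOpen W hW)
    (not_isCompact_closure_of_forall_interior_eq_empty hX (hB.isOpen W hW) (hB.nonempty W hW))

end NowhereLocallyCompact

theorem mainTheorem4_general {X : Type*} [TopologicalSpace X] [T3Space X] [Nonempty X]
    (hX : ∀ K : Set X, IsCompact K → interior K = ∅) {B : Set (Set X)} (hBc : B.Countable)
    (hB : IsPiBase B) :
    (∃ u : X → IliadisAbsolute X, IsFibreSelection u) ∧
    ∀ u : X → IliadisAbsolute X, IsFibreSelection u →
      (∃ V : ℕ → FreeOpenUltrafilter (SSpace u), IsOpenCovering V) ∧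
      ∀ V : ℕ → FreeOpenUltrafilter (SSpace u), IsOpenCovering V →
        T2Space (StarSpace V) ∧
        ExtremallyDisconnected (StarSpace V) ∧
        (∀ x : StarSpace V, ¬ IsOpen ({x} : Set (StarSpace V))) ∧
        (Countable X → Countable (StarSpace V)) ∧
        IsSHD (StarSpace V) ∧
        ¬ IsSemiregular (StarSpace V) := by
  refine ⟨exists_isFibreSelection X, fun u hu =>
    ⟨SSpace.exists_isOpenCovering hX hBc hB hu, fun V hV => ?_⟩⟩
  have hT2 : T2Space (SSpace u) := SSpace.t2Space hu
  have hED : ExtremallyDisconnected (SSpace u) := SSpace.extremallyDisconnected hu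
  have hEDstar : ExtremallyDisconnected (StarSpace V) := StarSpace.extremallyDisconnected
  have hiso : ∀ x : StarSpace V, ¬ IsOpen ({x} : Set (StarSpace V)) :=
    StarSpace.not_isOpen_singleton
      (SSpace.not_isOpen_singleton hu (not_isOpen_singleton_of_forall_interior_eq_empty hX))
  have hcount (_ : Countable X) : Countable (StarSpace V) :=
    have : Countable (SSpace u) := (SSpace.proj_bijective hu).injective.countable
    StarSpace.countable
  exact ⟨inferInstance, hEDstar, hiso, hcount,
    isSHD_of_extremallyDisconnected hiso, StarSpace.not_isSemiregular hV⟩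

theorem mainTheorem4 :
    (∃ u : ℚ → IliadisAbsolute ℚ, IsFibreSelection u) ∧
    ∀ u : ℚ → IliadisAbsolute ℚ, IsFibreSelection u →
      (∃ V : ℕ → FreeOpenUltrafilter (SSpace u), IsOpenCovering V) ∧
      ∀ V : ℕ → FreeOpenUltrafilter (SSpace u), IsOpenCovering V →
        T2Space (StarSpace V) ∧
        ExtremallyDisconnected (StarSpace V) ∧
        (∀ x : StarSpace V, ¬ IsOpen ({x} : Set (StarSpace V))) ∧
        Countable (StarSpace V) ∧
        IsSHD (StarSpace V) ∧
        ¬ IsSemiregular (StarSpace V) := by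
  simpa only [show Countable ℚ from inferInstance, true_imp_iff] using
    mainTheorem4_general (fun _ => Rat.interior_compact_eq_empty)
      (TopologicalSpace.countable_countableBasis ℚ) isPiBase_countableBasis
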